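/- Let $O$ be a convex polygon in the plane: the obstacle is its open interior region, and the free space is $F=\mathbb{R}^2\setminus O$, so that the boundary of the polygon belongs to $F$. A point $x\in F$ is visible from $y\in F$ if the segment $\overline{xy}$ does not meet the open region $O$. A path is a continuous map $f:[0,1]\to F$; it is a watchman route starting at $s$ if $f(0)=s$ and every point of $F$ is visible from some point of $f([0,1])$. Let $\mathrm{OPT}(O,s)$ be the minimal (infimal) length of a watchman route around $O$ starting at $s$. For a path $f$ let $v_f(t)$ be the set of vertices of $O$ that are visible from some point of $f([0,t])$. An online watchman algorithm is a function $h$ of a starting point, a set of seen vertices and a time $t\in[0,1]$ such that for every convex polygon $O$ and every starting point $s\in F$ there is a watchman route $f$ for $O$ starting at $s$ with $f(t)=h(s,v_f(t),t)$ for all $t\in[0,1]$. Then for every online watchman algorithm $h$ and every $\varepsilon>0$ there are a triangular obstacle $O$, with two sides of equal length $\ell$ and third side of length at most $\varepsilon\ell$, and a starting point $s\in F$, such that $0<\mathrm{OPT}(O,s)<\infty$ and every watchman route $f$ for $O$ starting at $s$ with $f(t)=h(s,v_f(t),t)$ for all $t\in[0,1]$ (at least one such route exists) satisfies $$\frac{\mathrm{length}(f)}{\mathrm{OPT}(O,s)}>3-\varepsilon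 .$$ -/

import Mathlib

open Set
open scoped ENNReal

namespace Watchman

/-- The Euclidean plane. -/
abbrev Plane : Type := EuclideanSpace ℝ (Fin 2)

/-- A (nondegenerate) convex polygon, given by its vertices: at least three points, none of which
lies in the convex hull of the others. -/
structure ConvexPolygon where
  vertices : Finset Plane
  three_le_card : 3 ≤ vertices.card
  convexIndependent : ConvexIndependent ℝ (fun v : vertices => (v : Plane))

namespace ConvexPolygon

variable (O : ConvexPolygon)

/-- The region that blocks motion and sight: the open polygonal region. The robot may touch and
walk along the edges, and the vertices are points that can be seen. -/
def obstacle : Set Plane := interior (convexHull ℝ (O.vertices : Set Plane))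

/-- The free space, the complement of the obstacle. -/
def free : Set Plane := O.obstacleᶜ

/-- The set of points of the free space visible from some point of `S`. -/
def visible (S : Set Plane) : Set Plane :=
  {x | x ∈ O.free ∧ ∃ y ∈ S, segment ℝ x y ∩ O.obstacle = ∅}

/-- `f`, restricted to `[0,1]`, is a path in the free space. -/
def IsPath (f : ℝ → Plane) : Prop :=
  ContinuousOn f (Icc 0 1) ∧ MapsTo f (Icc 0 1) O.free

/-- `f` is a watchman route with starting point `s`: a path in the free space that starts at `s`
and from which all of the free space is seen. -/
def IsWatchmanRoute (s : Plane) (f : ℝ → Plane) : Prop :=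
  O.IsPath f ∧ f 0 = s ∧ O.visible (f '' Icc 0 1) = O.free

/-- The vertices seen from the path `f` up to (and including) time `t`. -/
def seenVertices (f : ℝ → Plane) (t : ℝ) : Set Plane :=
  (O.vertices : Set Plane) ∩ O.visible (f '' Icc 0 t)

end ConvexPolygon

/-- The length of a path on `[0,1]` (infinite if the path is not rectifiable). -/
noncomputable def pathLength (f : ℝ → Plane) : ℝ≥0∞ := eVariationOn f (Icc 0 1)

/-- The offline optimum: the least length of a watchman route around `O` starting at `s`. -/
noncomputable def opt (O : ConvexPolygon) (s : Plane) : ℝ≥0∞ :=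
  ⨅ (f : ℝ → Plane) (_ : O.IsWatchmanRoute s f), pathLength f

/-- `f` is a watchman route that the strategy `h` produces on the polygon `O` from the start `s`:
at every time `t` the position is determined by `s`, the set of vertices seen so far, and `t`. -/
def IsOnlineRoute (h : Plane → Set Plane → ℝ → Plane) (O : ConvexPolygon) (s : Plane)
    (f : ℝ → Plane) : Prop :=
  O.IsWatchmanRoute s f ∧ ∀ t ∈ Icc (0 : ℝ) 1, f t = h s (O.seenVertices f t) t

/-- An online watchman route algorithm: a function `h` of the starting point, the set of vertices
seen so far and the time, which produces a watchman route for every convex polygon and every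
starting point in its free space. -/
def IsOnlineWatchmanAlgorithm (h : Plane → Set Plane → ℝ → Plane) : Prop :=
  ∀ (O : ConvexPolygon) (s : Plane), s ∈ O.free → ∃ f : ℝ → Plane, IsOnlineRoute h O s f

end Watchman

/-!
Two congruent thin isosceles triangles lie below the segment from `(-1, 0)` to `(1, 0)`, which is a
leg of both; one has its apex at `(-1, 0)`, the other at `(1, 0)`. From the start `0` the robot sees
only these two points, and as long as the third vertex stays hidden it cannot tell the triangles
apart, so it moves in the same way around both. It learns more only after going past one of the two
endpoints. If that endpoint is the apex, the robot has to come back and see the short base as well,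
so it has walked a distance of nearly `1 + 2`, whereas a short route from `0` to the base and along
it has length about `1`.

The barycentric coordinate `c` at the apex measures this. It is `1 / 2` at the start, at least `1`
beyond the apex and at most `0` beyond the base, so along the route it varies by at least `3 / 2`,
while `c` is Lipschitz with a constant that tends to `1 / 2` as the triangles get thinner.
-/

open scoped NNReal Topology

namespace Watchman

section PathLength

lemma edist_add_edist_le_eVariationOn {α E : Type*} [LinearOrder α] [PseudoEMetricSpace E]
    (f : α → E) {S : Set α} {a b c : α} (ha : a ∈ S) (hb : b ∈ S) (hc : c ∈ S) (hab : a ≤ b)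
    (hbc : b ≤ c) : edist (f a) (f b) + edist (f b) (f c) ≤ eVariationOn f S :=
  calc edist (f a) (f b) + edist (f b) (f c)
      ≤ eVariationOn f (S ∩ Icc a b) + eVariationOn f (S ∩ Icc b c) :=
        add_le_add (eVariationOn.edist_le f ⟨ha, le_rfl, hab⟩ ⟨hb, hab, le_rfl⟩)
          (eVariationOn.edist_le f ⟨hb, le_rfl, hbc⟩ ⟨hc, hbc, le_rfl⟩)
    _ = eVariationOn f (S ∩ Icc a c) := eVariationOn.Icc_add_Icc f hab hbc hb
    _ ≤ eVariationOn f S := eVariationOn.mono f inter_subset_left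

lemma eVariationOn_extend_trans {E : Type*} [PseudoEMetricSpace E] {x y z : E} (γ : Path x y)
    (γ' : Path y z) : eVariationOn (γ.trans γ').extend (Icc 0 1) =
      eVariationOn γ.extend (Icc 0 1) + eVariationOn γ'.extend (Icc 0 1) := by
  have split := eVariationOn.Icc_add_Icc (γ.trans γ').extend (s := univ) (a := 0) (b := 1 / 2)
    (c := 1) (by norm_num) (by norm_num) (mem_univ _)
  have first_half : eVariationOn (γ.trans γ').extend (Icc 0 (1 / 2)) =
      eVariationOn γ.extend (Icc 0 1) := by
    rw [eVariationOn.congr (g := γ.extend ∘ fun t => 2 * t)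
      fun t ht => Path.extend_trans_of_le_half γ γ' ht.2,
      eVariationOn.comp_eq_of_monotoneOn _ _ fun a _ b _ hab => by simpa using hab,
      image_mul_left_Icc (by norm_num) (by norm_num)]
    norm_num
  have second_half : eVariationOn (γ.trans γ').extend (Icc (1 / 2) 1) =
      eVariationOn γ'.extend (Icc 0 1) := by
    rw [eVariationOn.congr (g := γ'.extend ∘ fun t => 2 * t + (-1))
      fun t ht => Path.extend_trans_of_half_le γ γ' ht.1,
      eVariationOn.comp_eq_of_monotoneOn _ _ fun a _ b _ hab => by simpa using hab,
      image_affine_Icc' (by norm_num)]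
    norm_num
  rw [← first_half, ← second_half]
  simpa only [univ_inter] using split.symm

lemma eVariationOn_extend_segment_le {E : Type*} [SeminormedAddCommGroup E] [NormedSpace ℝ E]
    (x y : E) : eVariationOn (Path.segment x y).extend (Icc 0 1) ≤ edist x y :=
  calc eVariationOn (Path.segment x y).extend (Icc 0 1)
      = eVariationOn (AffineMap.lineMap x y ∘ (id : ℝ → ℝ)) (Icc 0 1) :=
        eVariationOn.congr (Path.eqOn_extend_segment x y)
    _ ≤ nndist x y * eVariationOn (id : ℝ → ℝ) (Icc 0 1) :=
        (lipschitzWith_lineMap x y).lipschitzOnWith.comp_eVariationOn_le (mapsTo_univ _ _)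
    _ = edist x y := by
        rw [eVariationOn_id_Icc, ← edist_nndist]
        simp

end PathLength

section FirstExit

variable {X : Type*} {U : Set X} {f g γ : ℝ → X} {τ τ' : ℝ}

/-- `τ` is the first time in `[0, 1]` at which `f`, having started inside `U`, is outside `U`. -/
structure IsFirstExit (U : Set X) (f : ℝ → X) (τ : ℝ) : Prop where
  pos : 0 < τ
  le_one : τ ≤ 1
  mapsTo : MapsTo f (Ico 0 τ) U
  notMem : f τ ∉ U

lemma IsFirstExit.le_of_notMem (hτ : IsFirstExit U f τ) {t : ℝ} (ht : 0 ≤ t) (hft : f t ∉ U) :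
    τ ≤ t :=
  not_lt.1 fun htτ => hft (hτ.mapsTo ⟨ht, htτ⟩)

variable [TopologicalSpace X]

lemma exists_isFirstExit (hU : IsOpen U) (hf : ContinuousOn f (Icc 0 1)) (h0 : f 0 ∈ U)
    (hexit : ∃ t ∈ Icc (0 : ℝ) 1, f t ∉ U) : ∃ τ, IsFirstExit U f τ := by
  have hclosed : IsClosed (Icc 0 1 ∩ f ⁻¹' Uᶜ) :=
    hf.preimage_isClosed_of_isClosed isClosed_Icc hU.isClosed_compl
  obtain ⟨τ, ⟨⟨hτ0, hτ1⟩, hτU⟩, hleast⟩ :=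
    (isCompact_Icc.of_isClosed_subset hclosed inter_subset_left).exists_isLeast hexit
  refine ⟨τ, hτ0.lt_of_ne ?_, hτ1, fun t ht => ?_, hτU⟩
  · rintro rfl
    exact hτU h0
  · by_contra htU
    exact ht.2.not_ge (hleast ⟨⟨ht.1, ht.2.le.trans hτ1⟩, htU⟩)

lemma IsFirstExit.mem_of_isClosed (hτ : IsFirstExit U f τ) (hf : ContinuousOn f (Icc 0 1))
    {C : Set X} (hC : IsClosed C) (hmaps : MapsTo f (Ico 0 τ) C) : f τ ∈ C := by
  have hclosure : τ ∈ closure (Ico 0 τ) := by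
    rw [closure_Ico hτ.pos.ne]
    exact right_mem_Icc.2 hτ.pos.le
  have hcont : ContinuousWithinAt f (Ico 0 τ) τ :=
    (hf τ ⟨hτ.pos.le, hτ.le_one⟩).mono fun t ht => ⟨ht.1, ht.2.le.trans hτ.le_one⟩
  exact hC.closure_subset_iff.2 hmaps.image_subset (hcont.mem_closure_image hclosure)

variable [T2Space X]

lemma eqOn_Icc_of_eqOn_Ico (hf : ContinuousOn f (Icc 0 1)) (hg : ContinuousOn g (Icc 0 1))
    (hτ0 : 0 < τ) (hτ1 : τ ≤ 1) (hfg : EqOn f g (Ico 0 τ)) : EqOn f g (Icc 0 τ) :=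
  hfg.of_subset_closure (hf.mono (Icc_subset_Icc_right hτ1)) (hg.mono (Icc_subset_Icc_right hτ1))
    Ico_subset_Icc_self (closure_Ico hτ0.ne).ge

lemma IsFirstExit.le_of_eqOn (hτ : IsFirstExit U f τ) (hτ' : IsFirstExit U g τ')
    (hf : ContinuousOn f (Icc 0 1)) (hg : ContinuousOn g (Icc 0 1)) (hfγ : EqOn f γ (Ico 0 τ))
    (hgγ : EqOn g γ (Ico 0 τ')) : τ ≤ τ' := by
  by_contra! hlt
  have hfg : EqOn f g (Icc 0 τ') := eqOn_Icc_of_eqOn_Ico hf hg hτ'.pos hτ'.le_one fun t ht =>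
    (hfγ ⟨ht.1, ht.2.trans hlt⟩).trans (hgγ ht).symm
  exact hτ'.notMem (hfg ⟨hτ'.pos.le, le_rfl⟩ ▸ hτ.mapsTo ⟨hτ'.pos.le, hlt⟩)

lemma IsFirstExit.eq_of_eqOn (hτ : IsFirstExit U f τ) (hτ' : IsFirstExit U g τ')
    (hf : ContinuousOn f (Icc 0 1)) (hg : ContinuousOn g (Icc 0 1)) (hfγ : EqOn f γ (Ico 0 τ))
    (hgγ : EqOn g γ (Ico 0 τ')) : f τ = g τ' := by
  obtain rfl : τ = τ' :=
    (hτ.le_of_eqOn hτ' hf hg hfγ hgγ).antisymm (hτ'.le_of_eqOn hτ hg hf hgγ hfγ)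
  exact eqOn_Icc_of_eqOn_Ico hf hg hτ.pos hτ.le_one (hfγ.trans hgγ.symm) ⟨hτ.pos.le, le_rfl⟩

end FirstExit

section Barycentric

variable {ι E : Type*} [AddCommGroup E] [Module ℝ E]

lemma coord_add_coord_add_coord (b : AffineBasis (Fin 3) ℝ E) (v : E) :
    b.coord 0 v + b.coord 1 v + b.coord 2 v = 1 := by
  rw [← Fin.sum_univ_three fun i => b.coord i v, b.sum_coord_apply_eq_one]

lemma convexIndependent_of_affineIndependent {p : ι → E} (hp : AffineIndependent ℝ p) :
    ConvexIndependent ℝ p :=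
  fun s i hi => (hp.mem_affineSpan_iff i s).1 (convexHull_subset_affineSpan _ hi)

lemma exists_mem_segment_forall_coord_pos [Finite ι] (b : AffineBasis ι ℝ E) {x y : E}
    (hx : ∀ i, 0 ≤ b.coord i x) (hy : ∀ i, b.coord i x = 0 → 0 < b.coord i y) :
    ∃ z ∈ segment ℝ x y, ∀ i, 0 < b.coord i z := by
  have hpos : ∀ i, ∀ᶠ t in 𝓝[>] (0 : ℝ),
      0 < AffineMap.lineMap (b.coord i x) (b.coord i y) t := by
    intro i
    rcases (hx i).eq_or_lt with hzero | hi
    · filter_upwards [self_mem_nhdsWithin] with t ht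
      simpa [← hzero, AffineMap.lineMap_apply] using mul_pos ht (hy i hzero.symm)
    · have hcont : Continuous (AffineMap.lineMap (b.coord i x) (b.coord i y) : ℝ → ℝ) :=
        AffineMap.lineMap_continuous
      refine nhdsWithin_le_nhds (hcont.continuousAt.eventually (lt_mem_nhds ?_))
      simpa using hi
  obtain ⟨t, ht, ht01⟩ := ((Filter.eventually_all.2 hpos).and (Ioo_mem_nhdsGT one_pos)).exists
  refine ⟨AffineMap.lineMap x y t, ?_, fun i => ?_⟩
  · rw [segment_eq_image_lineMap]
    exact mem_image_of_mem _ (Ioo_subset_Icc_self ht01)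
  · rw [AffineMap.apply_lineMap]
    exact ht i

/-- The open cone with apex `b i` spanned by the simplex with vertices `b`. Inside this cone the
simplex can be left only through the facet opposite to `b i`, so that `b i` stays hidden. -/
def openCone (b : AffineBasis ι ℝ E) (i : ι) : Set E := {v | ∀ j ≠ i, 0 < b.coord j v}

end Barycentric

lemma isOpen_openCone {ι E : Type*} [Finite ι] [NormedAddCommGroup E] [NormedSpace ℝ E]
    (b : AffineBasis ι ℝ E) (i : ι) : IsOpen (openCone b i) := by
  have : FiniteDimensional ℝ E := b.finiteDimensional
  simp only [openCone, ofPred_forall]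
  exact isOpen_iInter_of_finite fun j => isOpen_iInter_of_finite fun _ =>
    isOpen_lt continuous_const (continuous_barycentric_coord b j)

section Triangle

variable (b : AffineBasis (Fin 3) ℝ Plane)

/-- The triangle with vertices `b 0`, `b 1` and `b 2`; the barycentric coordinates of `b` describe
its obstacle and its free space by the signs of three affine functions. -/
noncomputable def triangle : ConvexPolygon where
  vertices := Finset.univ.map ⟨b, b.ind.injective⟩
  three_le_card := by rw [Finset.card_map, Finset.card_univ, Fintype.card_fin]
  convexIndependent := (convexIndependent_of_affineIndependent b.ind).range.mono (by simp)

lemma coe_vertices_triangle : ((triangle b).vertices : Set Plane) = range b := by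
  simp [triangle]

lemma obstacle_triangle : (triangle b).obstacle = {v | ∀ i, 0 < b.coord i v} := by
  rw [ConvexPolygon.obstacle, coe_vertices_triangle, b.interior_convexHull]

variable {b} {i j : Fin 3} {x y s : Plane} {S : Set Plane} {f : ℝ → Plane}

lemma mem_free_triangle : x ∈ (triangle b).free ↔ ∃ i, b.coord i x ≤ 0 := by
  simp only [ConvexPolygon.free, obstacle_triangle, mem_compl_iff, mem_ofPred_eq, not_forall,
    not_lt]

lemma coord_nonpos_of_mem_openCone (hx : x ∈ openCone b i) (hfree : x ∈ (triangle b).free) :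
    b.coord i x ≤ 0 := by
  obtain ⟨j, hj⟩ := mem_free_triangle.1 hfree
  obtain rfl : j = i := by
    by_contra hne
    exact hj.not_gt (hx j hne)
  exact hj

lemma segment_subset_free_triangle (hx : b.coord i x ≤ 0) (hy : b.coord i y ≤ 0) :
    segment ℝ x y ⊆ (triangle b).free := fun _ hz =>
  mem_free_triangle.2
    ⟨i, ((convex_Iic (0 : ℝ)).affine_preimage (b.coord i)).segment_subset hx hy hz⟩

lemma mem_visible_of_coord_nonpos (hx : b.coord i x ≤ 0) (hyS : y ∈ S) (hy : b.coord i y ≤ 0) :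
    x ∈ (triangle b).visible S :=
  ⟨mem_free_triangle.2 ⟨i, hx⟩, y, hyS,
    (subset_compl_iff_disjoint_right.1 (segment_subset_free_triangle hx hy)).inter_eq⟩

lemma exists_coord_nonpos_of_mem_visible (hx : ∀ i, 0 ≤ b.coord i x)
    (hvis : x ∈ (triangle b).visible S) : ∃ i, b.coord i x = 0 ∧ ∃ y ∈ S, b.coord i y ≤ 0 := by
  obtain ⟨-, y, hyS, hxy⟩ := hvis
  by_contra! hpos
  obtain ⟨z, hz, hz_pos⟩ :=
    exists_mem_segment_forall_coord_pos b hx fun i hi => hpos i hi y hyS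
  exact eq_empty_iff_forall_notMem.1 hxy z ⟨hz, (obstacle_triangle b).symm ▸ hz_pos⟩

lemma visible_eq_free_iff :
    (triangle b).visible S = (triangle b).free ↔ ∀ i, ∃ y ∈ S, b.coord i y ≤ 0 := by
  refine ⟨fun hvis i => ?_, fun hS => subset_antisymm (fun x hx => hx.1) fun x hx => ?_⟩
  · -- The midpoint of the edge opposite to `b i` is visible only from beyond that edge.
    have hcoord : ∀ j, b.coord j (midpoint ℝ (b (i + 1)) (b (i + 2))) =
        if j = i then 0 else 1 / 2 := by
      intro j
      rw [AffineMap.map_midpoint]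
      fin_cases i <;> fin_cases j <;> simp [b.coord_apply, midpoint_eq_smul_add]
    have hfree : midpoint ℝ (b (i + 1)) (b (i + 2)) ∈ (triangle b).free :=
      mem_free_triangle.2 ⟨i, by simp [hcoord]⟩
    obtain ⟨j, hj, hyS⟩ := exists_coord_nonpos_of_mem_visible
      (fun j => by rw [hcoord]; split_ifs <;> norm_num) (hvis ▸ hfree)
    obtain rfl : j = i := by
      by_contra hne
      norm_num [hcoord, hne] at hj
    exact hyS
  · obtain ⟨i, hi⟩ := mem_free_triangle.1 hx
    obtain ⟨y, hyS, hy⟩ := hS i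
    exact mem_visible_of_coord_nonpos hi hyS hy

lemma ConvexPolygon.IsWatchmanRoute.exists_coord_nonpos
    (hf : (triangle b).IsWatchmanRoute s f) (i : Fin 3) :
    ∃ t ∈ Icc (0 : ℝ) 1, b.coord i (f t) ≤ 0 :=
  exists_mem_image.1 (visible_eq_free_iff.1 hf.2.2 i)

lemma seenVertices_triangle {t : ℝ} (hf : MapsTo f (Icc 0 t) (openCone b i)) (ht : 0 ≤ t)
    (h0 : b.coord i (f 0) ≤ 0) : (triangle b).seenVertices f t = b '' {i}ᶜ := by
  rw [ConvexPolygon.seenVertices, coe_vertices_triangle]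
  ext v
  constructor
  · rintro ⟨⟨k, rfl⟩, hvis⟩
    refine mem_image_of_mem b fun hki => ?_
    obtain ⟨j, hj, _, ⟨r, hr, rfl⟩, hjr⟩ := exists_coord_nonpos_of_mem_visible
      (fun j => by rw [b.coord_apply]; split_ifs <;> norm_num) hvis
    have hji : j ≠ i := by
      rintro rfl
      rw [mem_singleton_iff.1 hki, b.coord_apply_eq] at hj
      exact one_ne_zero hj
    exact hjr.not_gt (hf hr j hji)
  · rintro ⟨k, hki, rfl⟩
    exact ⟨mem_range_self k, mem_visible_of_coord_nonpos (b.coord_apply_ne (Ne.symm hki)).le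
      (mem_image_of_mem f ⟨le_rfl, ht⟩) h0⟩

lemma opt_le_of_path {O : ConvexPolygon} {z : Plane} (γ : Path s z) (hγ : range γ ⊆ O.free)
    (hvis : O.visible (range γ) = O.free) : opt O s ≤ eVariationOn γ.extend (Icc 0 1) := by
  have himage : γ.extend '' Icc 0 1 = range γ :=
    γ.image_extend_of_subset subset_rfl
  exact iInf₂_le _ ⟨⟨γ.continuous_extend.continuousOn,
    mapsTo_iff_image_subset.2 (himage ▸ hγ)⟩, γ.extend_zero, himage ▸ hvis⟩

lemma opt_triangle_le (hij : i ≠ j) (hs : b.coord i s ≤ 0) :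
    opt (triangle b) s ≤ edist s (b j) + edist (b j) (b i) := by
  obtain ⟨k, hki, hkj⟩ : ∃ k, k ≠ i ∧ k ≠ j :=
    Fin.exists_ne_and_ne_of_two_lt i j (by norm_num)
  let γ : Path s (b i) := (Path.segment s (b j)).trans (Path.segment (b j) (b i))
  have hrange : range γ = segment ℝ s (b j) ∪ segment ℝ (b j) (b i) := by
    rw [Path.trans_range, Path.range_segment, Path.range_segment]
  have hfree : range γ ⊆ (triangle b).free := by
    rw [hrange]
    exact union_subset (segment_subset_free_triangle hs (b.coord_apply_ne hij).le)
      (segment_subset_free_triangle (b.coord_apply_ne hkj).le (b.coord_apply_ne hki).le)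
  have hvis : (triangle b).visible (range γ) = (triangle b).free := by
    rw [visible_eq_free_iff, hrange]
    intro m
    by_cases hmj : m = j
    · exact ⟨b i, Or.inr (right_mem_segment ..), (b.coord_apply_ne (hmj ▸ hij.symm)).le⟩
    · exact ⟨b j, Or.inr (left_mem_segment ..), (b.coord_apply_ne hmj).le⟩
  calc opt (triangle b) s ≤ eVariationOn γ.extend (Icc 0 1) := opt_le_of_path γ hfree hvis
    _ ≤ edist s (b j) + edist (b j) (b i) := by
      rw [eVariationOn_extend_trans]
      exact add_le_add (eVariationOn_extend_segment_le ..) (eVariationOn_extend_segment_le ..)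

lemma ofReal_coord_div_le_opt {K : ℝ≥0} (hK : LipschitzWith K (b.coord i)) :
    ENNReal.ofReal (b.coord i s) / K ≤ opt (triangle b) s := by
  refine le_iInf₂ fun f hf => ENNReal.div_le_of_le_mul' ?_
  obtain ⟨t, ht, hft⟩ := hf.exists_coord_nonpos i
  calc ENNReal.ofReal (b.coord i s)
      ≤ edist (b.coord i (f 0)) (b.coord i (f t)) := by
        rw [edist_dist, Real.dist_eq, hf.2.1]
        exact ENNReal.ofReal_le_ofReal (le_abs.2 (.inl (by linarith)))
    _ ≤ eVariationOn (b.coord i ∘ f) (Icc 0 1) :=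
        eVariationOn.edist_le _ (left_mem_Icc.2 zero_le_one) ht
    _ ≤ K * pathLength f := hK.lipschitzOnWith.comp_eVariationOn_le (mapsTo_univ _ _)

end Triangle

section ThinTriangle

/-- The two points `(1, 0)` and `(-1, 0)`, which the robot sees from the start `0`; they are
indexed by their sign. -/
noncomputable def endpoint (σ : ℤˣ) : Plane := !₂[((σ : ℤ) : ℝ), 0]

/-- The vertex of the thin triangle with sign `σ` that is hidden from the start. The leg from
`endpoint (-σ)` to `endpoint σ` is rotated about `endpoint (-σ)` by the apex angle into the lower
half-plane, and `u` is the tangent of half that angle, which makes the coordinates rational. -/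
noncomputable def hiddenVertex (u : ℝ) (σ : ℤˣ) : Plane :=
  endpoint (-σ) + (2 / (1 + u ^ 2)) • !₂[σ * (1 - u ^ 2), -(2 * u)]

variable {u : ℝ} (hu : 0 < u) (σ : ℤˣ)

lemma cast_units_sq : ((σ : ℤ) : ℝ) ^ 2 = 1 := by
  rw [← sq_abs, abs_unit_intCast, one_pow]

@[simp] lemma endpoint_apply_zero : endpoint σ 0 = σ := rfl

@[simp] lemma endpoint_apply_one : endpoint σ 1 = 0 := rfl

@[simp] lemma hiddenVertex_apply_zero :
    hiddenVertex u σ 0 = -σ + 2 / (1 + u ^ 2) * (σ * (1 - u ^ 2)) := by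
  simp [hiddenVertex]

@[simp] lemma hiddenVertex_apply_one :
    hiddenVertex u σ 1 = -(4 * u / (1 + u ^ 2)) := by
  simp only [hiddenVertex, PiLp.add_apply, endpoint_apply_one, PiLp.smul_apply,
    Matrix.cons_val_one, Matrix.cons_val_fin_one, smul_eq_mul, mul_neg, zero_add, neg_inj]
  ring

include hu in
lemma affineIndependent_thin :
    AffineIndependent ℝ ![endpoint (-σ), endpoint σ, hiddenVertex u σ] := by
  rw [affineIndependent_iff_not_collinear_set,
    collinear_iff_of_mem (mem_insert (endpoint (-σ)) _)]
  rintro ⟨v, hv⟩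
  obtain ⟨r, hr⟩ := hv (endpoint σ) (by simp)
  obtain ⟨q, hq⟩ := hv (hiddenVertex u σ) (by simp)
  have hr0 : (σ : ℝ) = r * v 0 + -σ := by simpa using congrArg (· 0) hr
  have hr1 : r = 0 ∨ v 1 = 0 := by simpa using congrArg (· 1) hr
  have hq1 : -(4 * u / (1 + u ^ 2)) = q * v 1 := by simpa using congrArg (· 1) hq
  have hv1 : v 1 ≠ 0 := right_ne_zero_of_mul (hq1 ▸ neg_ne_zero.2 (by positivity))
  rw [hr1.resolve_right hv1] at hr0
  nlinarith [cast_units_sq σ]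

/-- The barycentric frame of the thin triangle with sign `σ`: the apex `endpoint (-σ)`, the end
`endpoint σ` of the leg through the start, and the hidden vertex, in this order. -/
noncomputable def thinBasis : AffineBasis (Fin 3) ℝ Plane where
  toFun := ![endpoint (-σ), endpoint σ, hiddenVertex u σ]
  ind' := affineIndependent_thin hu σ
  tot' := (affineIndependent_thin hu σ).affineSpan_eq_top_iff_card_eq_finrank_add_one.2 (by simp)

@[simp] lemma thinBasis_zero : thinBasis hu σ 0 = endpoint (-σ) := rfl

@[simp] lemma thinBasis_one : thinBasis hu σ 1 = endpoint σ := rfl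

@[simp] lemma thinBasis_two : thinBasis hu σ 2 = hiddenVertex u σ := rfl

lemma apply_eq_sum_coord_thinBasis (v : Plane) (k : Fin 2) :
    v k = (thinBasis hu σ).coord 0 v * endpoint (-σ) k + (thinBasis hu σ).coord 1 v * endpoint σ k +
      (thinBasis hu σ).coord 2 v * hiddenVertex u σ k := by
  conv_lhs => rw [← (thinBasis hu σ).linear_combination_coord_eq_self v, Fin.sum_univ_three]
  rfl

lemma coord_two_thinBasis (v : Plane) :
    (thinBasis hu σ).coord 2 v = -((1 + u ^ 2) / (4 * u)) * v 1 := by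
  rw [apply_eq_sum_coord_thinBasis hu σ v 1, endpoint_apply_one, endpoint_apply_one,
    hiddenVertex_apply_one]
  field_simp
  ring

lemma coord_two_thinBasis_nonpos_iff {v : Plane} : (thinBasis hu σ).coord 2 v ≤ 0 ↔ 0 ≤ v 1 := by
  rw [coord_two_thinBasis, neg_mul, neg_nonpos, mul_nonneg_iff_of_pos_left (by positivity)]

lemma coord_zero_thinBasis (v : Plane) :
    (thinBasis hu σ).coord 0 v = (1 - σ * v 0 + u * v 1) / 2 := by
  rw [apply_eq_sum_coord_thinBasis hu σ v 0, apply_eq_sum_coord_thinBasis hu σ v 1,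
    eq_sub_iff_add_eq'.2 (coord_add_coord_add_coord _ v)]
  simp only [endpoint_apply_zero, endpoint_apply_one, hiddenVertex_apply_zero,
    hiddenVertex_apply_one, Units.val_neg, Int.cast_neg]
  field_simp
  linear_combination (1 - 3 * u ^ 2 - 2 * (1 - u ^ 2) * (thinBasis hu σ).coord 0 v +
    4 * u ^ 2 * (thinBasis hu σ).coord 1 v) * cast_units_sq σ

lemma coord_zero_thinBasis_add_neg (v : Plane) :
    (thinBasis hu σ).coord 0 v + (thinBasis hu (-σ)).coord 0 v = 1 + u * v 1 := by
  simp only [coord_zero_thinBasis, Units.val_neg, Int.cast_neg]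
  ring

lemma lipschitzWith_coord_zero_thinBasis :
    LipschitzWith (Real.toNNReal ((1 + u) / 2)) ((thinBasis hu σ).coord 0) := by
  refine LipschitzWith.of_dist_le' fun v w => ?_
  have hcoord : ∀ k, |v k - w k| ≤ dist v w := fun k => by
    simpa [dist_eq_norm] using PiLp.norm_apply_le (v - w) k
  calc dist ((thinBasis hu σ).coord 0 v) ((thinBasis hu σ).coord 0 w)
      = |u * (v 1 - w 1) - σ * (v 0 - w 0)| / 2 := by
        rw [Real.dist_eq, coord_zero_thinBasis, coord_zero_thinBasis, ← abs_two, ← abs_div, abs_two]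
        ring_nf
    _ ≤ (u * |v 1 - w 1| + |v 0 - w 0|) / 2 := by
        gcongr
        simpa only [abs_mul, abs_of_pos hu, abs_unit_intCast, one_mul] using
          abs_sub (u * (v 1 - w 1)) (σ * (v 0 - w 0))
    _ ≤ (u * dist v w + dist v w) / 2 := by gcongr <;> exact hcoord _
    _ = (1 + u) / 2 * dist v w := by ring

lemma dist_sq_plane (x y : Plane) : dist x y ^ 2 = (x 0 - y 0) ^ 2 + (x 1 - y 1) ^ 2 := by
  simp only [EuclideanSpace.dist_sq_eq, Fin.sum_univ_two, Real.dist_eq, sq_abs]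

lemma dist_zero_endpoint : dist 0 (endpoint σ) = 1 := by
  rw [← sq_eq_sq₀ dist_nonneg zero_le_one, dist_sq_plane]
  simp [cast_units_sq]

lemma dist_apex_endpoint : dist (endpoint (-σ)) (endpoint σ) = 2 := by
  rw [← sq_eq_sq₀ dist_nonneg zero_le_two, dist_sq_plane]
  simp only [endpoint_apply_zero, endpoint_apply_one, Units.val_neg, Int.cast_neg]
  linear_combination 4 * cast_units_sq σ

lemma dist_apex_hiddenVertex : dist (endpoint (-σ)) (hiddenVertex u σ) = 2 := by
  rw [← sq_eq_sq₀ dist_nonneg zero_le_two, dist_sq_plane]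
  simp only [endpoint_apply_zero, endpoint_apply_one, hiddenVertex_apply_zero,
    hiddenVertex_apply_one, Units.val_neg, Int.cast_neg]
  field_simp
  linear_combination 4 * (1 - u ^ 2) ^ 2 * cast_units_sq σ

include hu in
lemma dist_endpoint_hiddenVertex_le : dist (endpoint σ) (hiddenVertex u σ) ≤ 4 * u := by
  rw [← sq_le_sq₀ dist_nonneg (by positivity), dist_sq_plane]
  calc (endpoint σ 0 - hiddenVertex u σ 0) ^ 2 + (endpoint σ 1 - hiddenVertex u σ 1) ^ 2
      = (4 * u) ^ 2 / (1 + u ^ 2) := by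
        simp only [endpoint_apply_zero, endpoint_apply_one, hiddenVertex_apply_zero,
          hiddenVertex_apply_one]
        field_simp
        linear_combination 16 * u ^ 4 * cast_units_sq σ
    _ ≤ (4 * u) ^ 2 := div_le_self (by positivity) (by nlinarith)

lemma coe_vertices_thin : ((triangle (thinBasis hu σ)).vertices : Set Plane) =
    {endpoint (-σ), endpoint σ, hiddenVertex u σ} := by
  rw [coe_vertices_triangle]
  ext v
  simp [Fin.exists_fin_succ, eq_comm]

lemma zero_mem_free_thin : 0 ∈ (triangle (thinBasis hu σ)).free :=
  mem_free_triangle.2 ⟨2, (coord_two_thinBasis_nonpos_iff hu σ).2 le_rfl⟩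

lemma opt_thin_le : opt (triangle (thinBasis hu σ)) 0 ≤ ENNReal.ofReal (1 + 4 * u) := by
  refine (opt_triangle_le (i := 2) (j := 1) (by decide)
    ((coord_two_thinBasis_nonpos_iff hu σ).2 le_rfl)).trans ?_
  rw [edist_dist, edist_dist, ← ENNReal.ofReal_add dist_nonneg dist_nonneg]
  exact ENNReal.ofReal_le_ofReal
    (add_le_add (dist_zero_endpoint σ).le (dist_endpoint_hiddenVertex_le hu σ))

lemma opt_thin_pos : 0 < opt (triangle (thinBasis hu σ)) 0 := by
  refine lt_of_lt_of_le ?_ (ofReal_coord_div_le_opt (lipschitzWith_coord_zero_thinBasis hu σ))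
  exact ENNReal.div_pos (by simp [coord_zero_thinBasis]) ENNReal.coe_ne_top

end ThinTriangle

section Online

variable {u : ℝ} (hu : 0 < u) {h : Plane → Set Plane → ℝ → Plane} {σ : ℤˣ} {k : ℝ → Plane} {τ : ℝ}

/-- The points whose barycentric coordinates, except possibly the one of the hidden vertex, are
positive with respect to both thin triangles. As long as the robot stays here, it sees just the two
endpoints, whichever of the two triangles is the obstacle. -/
def blindRegion : Set Plane := ⋂ σ, openCone (thinBasis hu σ) 2

lemma isOpen_blindRegion : IsOpen (blindRegion hu) :=
  isOpen_iInter_of_finite fun σ => isOpen_openCone (thinBasis hu σ) 2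

lemma zero_mem_blindRegion : 0 ∈ blindRegion hu := by
  refine mem_iInter.2 fun σ => ?_
  have h0 : (thinBasis hu σ).coord 0 0 = 1 / 2 := by simp [coord_zero_thinBasis]
  have h2 : (thinBasis hu σ).coord 2 0 = 0 := by simp [coord_two_thinBasis]
  have hsum := coord_add_coord_add_coord (thinBasis hu σ) 0
  intro j hj
  obtain rfl | rfl : j = 0 ∨ j = 1 := by omega
  · exact h0 ▸ one_half_pos
  · linarith

variable {hu}

lemma thinBasis_image_compl_two : thinBasis hu σ '' {2}ᶜ = range endpoint := by
  have hcompl : ({2}ᶜ : Set (Fin 3)) = {0, 1} := by ext i; fin_cases i <;> simp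
  have huniv : (univ : Set ℤˣ) = {-σ, σ} :=
    (eq_univ_of_forall fun ρ => by revert ρ σ; decide).symm
  rw [hcompl, image_pair, ← image_univ, huniv, image_pair, thinBasis_zero, thinBasis_one]

lemma notMem_blindRegion_of_coord_zero_nonpos {v : Plane} (hv : (thinBasis hu σ).coord 0 v ≤ 0) :
    v ∉ blindRegion hu := fun hmem =>
  hv.not_gt (mem_iInter.1 hmem σ 0 (by decide))

/-- The robot leaves the blind region past one of the two endpoints, and `ρ` is the triangle that
has this endpoint as its apex. -/
lemma exists_one_le_coord_zero_of_notMem {p : Plane} (hp : p ∉ blindRegion hu) (hp1 : 0 ≤ p 1) :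
    ∃ ρ, 1 ≤ (thinBasis hu ρ).coord 0 p := by
  obtain ⟨σ, j, hj, hjp⟩ : ∃ σ, ∃ j ≠ 2, (thinBasis hu σ).coord j p ≤ 0 := by
    simpa only [blindRegion, openCone, mem_iInter, mem_ofPred_eq, not_forall, not_lt, exists_prop]
      using hp
  obtain rfl | rfl : j = 0 ∨ j = 1 := by omega
  · exact ⟨-σ, by linarith [coord_zero_thinBasis_add_neg hu σ p, mul_nonneg hu.le hp1]⟩
  · exact ⟨σ, by linarith [coord_add_coord_add_coord (thinBasis hu σ) p,
      (coord_two_thinBasis_nonpos_iff hu σ).2 hp1]⟩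

lemma IsOnlineRoute.continuousOn {O : ConvexPolygon} {s : Plane} (hk : IsOnlineRoute h O s k) :
    ContinuousOn k (Icc 0 1) :=
  hk.1.1.1

lemma IsOnlineRoute.apply_zero {O : ConvexPolygon} {s : Plane} (hk : IsOnlineRoute h O s k) :
    k 0 = s :=
  hk.1.2.1

lemma IsOnlineRoute.exists_isFirstExit (hk : IsOnlineRoute h (triangle (thinBasis hu σ)) 0 k) :
    ∃ τ, IsFirstExit (blindRegion hu) k τ := by
  obtain ⟨t, ht, hkt⟩ := hk.1.exists_coord_nonpos 0
  exact Watchman.exists_isFirstExit (isOpen_blindRegion hu) hk.continuousOn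
    (hk.apply_zero ▸ zero_mem_blindRegion hu)
    ⟨t, ht, notMem_blindRegion_of_coord_zero_nonpos hkt⟩

lemma IsOnlineRoute.eqOn_of_isFirstExit (hk : IsOnlineRoute h (triangle (thinBasis hu σ)) 0 k)
    (hτ : IsFirstExit (blindRegion hu) k τ) : EqOn k (h 0 (range endpoint)) (Ico 0 τ) := by
  intro t ht
  have hcone : MapsTo k (Icc 0 t) (openCone (thinBasis hu σ) 2) := fun r hr =>
    mem_iInter.1 (hτ.mapsTo ⟨hr.1, hr.2.trans_lt ht.2⟩) σ
  have h0 : (thinBasis hu σ).coord 2 (k 0) ≤ 0 :=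
    hk.apply_zero ▸ (coord_two_thinBasis_nonpos_iff hu σ).2 le_rfl
  rw [hk.2 t ⟨ht.1, ht.2.le.trans hτ.le_one⟩, seenVertices_triangle hcone ht.1 h0,
    thinBasis_image_compl_two]

lemma IsOnlineRoute.exists_one_le_coord_zero (hk : IsOnlineRoute h (triangle (thinBasis hu σ)) 0 k)
    (hτ : IsFirstExit (blindRegion hu) k τ) : ∃ ρ, 1 ≤ (thinBasis hu ρ).coord 0 (k τ) := by
  have hclosed : IsClosed {v : Plane | 0 ≤ v 1} :=
    isClosed_le continuous_const (EuclideanSpace.proj (𝕜 := ℝ) 1).continuous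
  have habove : MapsTo k (Ico 0 τ) {v | 0 ≤ v 1} := fun t ht =>
    (coord_two_thinBasis_nonpos_iff hu σ).1 <| coord_nonpos_of_mem_openCone
      (mem_iInter.1 (hτ.mapsTo ht) σ) (hk.1.1.2 ⟨ht.1, ht.2.le.trans hτ.le_one⟩)
  exact exists_one_le_coord_zero_of_notMem hτ.notMem
    (hτ.mem_of_isClosed hk.continuousOn hclosed habove)

lemma IsOnlineRoute.le_pathLength (hk : IsOnlineRoute h (triangle (thinBasis hu σ)) 0 k)
    (hτ : IsFirstExit (blindRegion hu) k τ) (hkτ : 1 ≤ (thinBasis hu σ).coord 0 (k τ)) :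
    ENNReal.ofReal (3 / (1 + u)) ≤ pathLength k := by
  obtain ⟨t, ht, hkt⟩ := hk.1.exists_coord_nonpos 0
  have hτt : τ ≤ t := hτ.le_of_notMem ht.1 (notMem_blindRegion_of_coord_zero_nonpos hkt)
  have h0 : (thinBasis hu σ).coord 0 (k 0) = 1 / 2 := by simp [hk.apply_zero, coord_zero_thinBasis]
  have hvariation : ENNReal.ofReal (3 / 2) ≤ ENNReal.ofReal ((1 + u) / 2) * pathLength k :=
    calc ENNReal.ofReal (3 / 2)
        ≤ edist ((thinBasis hu σ).coord 0 (k 0)) ((thinBasis hu σ).coord 0 (k τ)) +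
          edist ((thinBasis hu σ).coord 0 (k τ)) ((thinBasis hu σ).coord 0 (k t)) := by
          rw [edist_dist, edist_dist, ← ENNReal.ofReal_add dist_nonneg dist_nonneg, h0,
            dist_comm, Real.dist_eq, Real.dist_eq]
          refine ENNReal.ofReal_le_ofReal ?_
          linarith [le_abs_self ((thinBasis hu σ).coord 0 (k τ) - 1 / 2),
            le_abs_self ((thinBasis hu σ).coord 0 (k τ) - (thinBasis hu σ).coord 0 (k t))]
      _ ≤ eVariationOn ((thinBasis hu σ).coord 0 ∘ k) (Icc 0 1) :=
        edist_add_edist_le_eVariationOn _ (left_mem_Icc.2 zero_le_one) ⟨hτ.pos.le, hτ.le_one⟩ ht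
          hτ.pos.le hτt
      _ ≤ ENNReal.ofReal ((1 + u) / 2) * pathLength k :=
        (lipschitzWith_coord_zero_thinBasis hu σ).lipschitzOnWith.comp_eVariationOn_le
          (mapsTo_univ _ _)
  rw [show 3 / (1 + u) = (3 / 2) / ((1 + u) / 2) by field_simp,
    ENNReal.ofReal_div_of_pos (by positivity)]
  exact ENNReal.div_le_of_le_mul' hvariation

variable (hu) in
lemma exists_forall_isOnlineRoute_le_pathLength (hh : IsOnlineWatchmanAlgorithm h) :
    ∃ σ, ∀ k, IsOnlineRoute h (triangle (thinBasis hu σ)) 0 k →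
      ENNReal.ofReal (3 / (1 + u)) ≤ pathLength k := by
  obtain ⟨f, hf⟩ := hh _ 0 (zero_mem_free_thin hu 1)
  obtain ⟨τ, hτ⟩ := hf.exists_isFirstExit
  obtain ⟨ρ, hρ⟩ := hf.exists_one_le_coord_zero hτ
  refine ⟨ρ, fun k hk => ?_⟩
  obtain ⟨τ', hτ'⟩ := hk.exists_isFirstExit
  have hexit : f τ = k τ' := hτ.eq_of_eqOn hτ' hf.continuousOn hk.continuousOn
    (hf.eqOn_of_isFirstExit hτ) (hk.eqOn_of_isFirstExit hτ')
  exact hk.le_pathLength hτ' (hexit ▸ hρ)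

end Online

lemma exists_thin_parameter {ε : ℝ} (hε : 0 < ε) :
    ∃ u > 0, 2 * u ≤ ε ∧ 3 - ε < 3 / (1 + u) / (1 + 4 * u) := by
  have hcont : ContinuousAt (fun u : ℝ => 3 / (1 + u) / (1 + 4 * u)) 0 := by
    fun_prop (disch := norm_num)
  have hratio : ∀ᶠ u in 𝓝[>] (0 : ℝ), 3 - ε < 3 / (1 + u) / (1 + 4 * u) :=
    nhdsWithin_le_nhds (hcont.eventually (lt_mem_nhds (by norm_num [hε])))
  obtain ⟨u, hu, hu0, huε⟩ := (hratio.and (Ioo_mem_nhdsGT (half_pos hε))).exists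
  exact ⟨u, hu0, by linarith, hu⟩

end Watchman

theorem mainTheorem3 (h : Watchman.Plane → Set Watchman.Plane → ℝ → Watchman.Plane)
    (hh : Watchman.IsOnlineWatchmanAlgorithm h) (ε : ℝ) (hε : 0 < ε) :
    ∃ (O : Watchman.ConvexPolygon) (A B C s : Watchman.Plane),
      (O.vertices : Set Watchman.Plane) = {A, B, C} ∧
      dist A B = dist A C ∧ dist B C ≤ ε * dist A B ∧
      s ∈ O.free ∧
      0 < Watchman.opt O s ∧ Watchman.opt O s < ⊤ ∧
      (∃ f : ℝ → Watchman.Plane, Watchman.IsOnlineRoute h O s f) ∧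
      ∀ f : ℝ → Watchman.Plane, Watchman.IsOnlineRoute h O s f →
        ENNReal.ofReal (3 - ε) < Watchman.pathLength f / Watchman.opt O s := by
  obtain ⟨u, hu, huε, hratio⟩ := Watchman.exists_thin_parameter hε
  obtain ⟨σ, hlong⟩ := Watchman.exists_forall_isOnlineRoute_le_pathLength hu hh
  refine ⟨Watchman.triangle (Watchman.thinBasis hu σ), Watchman.endpoint (-σ), Watchman.endpoint σ,
    Watchman.hiddenVertex u σ, 0, Watchman.coe_vertices_thin hu σ, ?_, ?_,
    Watchman.zero_mem_free_thin hu σ, Watchman.opt_thin_pos hu σ,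
    (Watchman.opt_thin_le hu σ).trans_lt ENNReal.ofReal_lt_top,
    hh _ 0 (Watchman.zero_mem_free_thin hu σ), fun f hf => ?_⟩
  · rw [Watchman.dist_apex_endpoint, Watchman.dist_apex_hiddenVertex]
  · rw [Watchman.dist_apex_endpoint]
    linarith [Watchman.dist_endpoint_hiddenVertex_le hu σ]
  · calc ENNReal.ofReal (3 - ε) < ENNReal.ofReal (3 / (1 + u) / (1 + 4 * u)) :=
          (ENNReal.ofReal_lt_ofReal_iff (by positivity)).2 hratio
      _ = ENNReal.ofReal (3 / (1 + u)) / ENNReal.ofReal (1 + 4 * u) :=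
          ENNReal.ofReal_div_of_pos (by positivity)
      _ ≤ Watchman.pathLength f / Watchman.opt (Watchman.triangle (Watchman.thinBasis hu σ)) 0 :=
          ENNReal.div_le_div (hlong f hf) (Watchman.opt_thin_le hu σ)
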